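/- For a matrix $Z\in\mathbb{R}^{n\times 2}$ with rows $Z_i$ and labels $Y\in\{-1,1\}^n$, the logistic regression objective is $\mathcal{L}(\beta\mid Z,Y)=\sum_{i=1}^n \ln(1+\exp(-Y_iZ_i\beta))$, $\beta\in\mathbb{R}^2$. For $0<\varepsilon<1$, a $(1\pm\varepsilon)$-coreset of $(Z,Y)$ of size $k$ is a collection of arbitrary points $c_1,\dots,c_k\in\mathbb{R}^2$ (labels folded in; not necessarily derived from input points) with weights $u_1,\dots,u_k>0$ such that for all $\beta\in\mathbb{R}^2$ $$\Bigl|\mathcal{L}(\beta\mid Z,Y)-\sum_{j=1}^k u_j\ln(1+\exp(c_j\beta))\Bigr|\le \varepsilon\,\mathcal{L}(\beta\mid Z,Y).$$ In the worst case, any coreset for logistic regression in $2$-dimensional Euclidean space consists of $\Omega(n/\log n)$ points: there is an absolute constant $c>0$ such that for every $n\ge 2$ there is an instance $Z\in\mathbb{R}^{n\times 2}$, $Y\in\{-1,1\}^n$ with the property that, for every $\varepsilon\in(0,1)$, every $(1\pm\varepsilon)$-coreset of $(Z,Y)$ has size $k\ge c\,n/\log n$. -/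

import Mathlib

open scoped Matrix

namespace LogisticRegression

noncomputable section

/-- The logistic loss `g(z) = ln (1 + exp z)`. -/
def g (z : ℝ) : ℝ := Real.log (1 + Real.exp z)

/-- The weighted logistic objective `f_w(v) = ∑ i, w i * g (v i)`, evaluated at `v = X *ᵥ β`. -/
def f {m : ℕ} (w : Fin m → ℝ) (v : Fin m → ℝ) : ℝ := ∑ i, w i * g (v i)

/-- Folding the labels into the data: the matrix with rows `x i = - Y i • Z i`, so that
`f 1 (fold Z Y *ᵥ β) = ∑ i, ln (1 + exp (- Y i * (Z i ⬝ᵥ β)))` is the negative log-likelihood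
of the instance `Z, Y` at `β`. -/
def fold {n d : ℕ} (Z : Matrix (Fin n) (Fin d) ℝ) (Y : Fin n → ℝ) : Matrix (Fin n) (Fin d) ℝ :=
  Matrix.of fun i j => -(Y i) * Z i j

/-- The points (rows) of `C`, with positive weights `u`, form a `(1 ± ε)`-coreset of the points
(rows) of `X`, weighted by `w`, for logistic regression. The rows of `C` are arbitrary points,
not necessarily rows of `X`, and no bound on their number `k` is imposed. -/
def IsCoreset {n k d : ℕ} (ε : ℝ) (X : Matrix (Fin n) (Fin d) ℝ) (w : Fin n → ℝ)
    (C : Matrix (Fin k) (Fin d) ℝ) (u : Fin k → ℝ) : Prop :=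
  (∀ i, 0 < u i) ∧
    ∀ β : Fin d → ℝ, |f w (X *ᵥ β) - f u (C *ᵥ β)| ≤ ε * f w (X *ᵥ β)

end

end LogisticRegression

open Filter Topology

namespace LogisticRegression

/-! Along a ray `t • β` on which all margins are negative, the loss decays like `exp (t * M)`, with
`M` the largest margin. A multiplicative approximation must therefore have the same `M`
(`IsCoreset.exists_le`, `IsCoreset.lt_of_forall_lt`). On a convex hyperbola branch each point is the
unique maximiser in some such direction, and no coreset point can serve two of them. Hence `n ≤ k`,
which is stronger than `n / log n`. -/

theorem g_nonneg (z : ℝ) : 0 ≤ g z :=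
  Real.log_nonneg (by linarith [Real.exp_pos z])

theorem g_le_exp (z : ℝ) : g z ≤ Real.exp z := by
  have := Real.log_le_sub_one_of_pos (show 0 < 1 + Real.exp z by positivity)
  unfold g
  linarith

theorem g_mono {a b : ℝ} (h : a ≤ b) : g a ≤ g b :=
  Real.log_le_log (by positivity) (by linarith [Real.exp_le_exp.2 h])

/-- With `g_le_exp`, this makes `g` comparable to `exp` on `z ≤ 0`. -/
theorem exp_div_two_le_g {z : ℝ} (hz : z ≤ 0) : Real.exp z / 2 ≤ g z := by
  have hpos : 0 < Real.exp z := Real.exp_pos z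
  have hle : Real.exp z ≤ 1 := Real.exp_le_one_iff.2 hz
  have h := Real.one_sub_inv_le_log_of_pos (show 0 < 1 + Real.exp z by positivity)
  refine le_trans ?_ h
  have : 1 - (1 + Real.exp z)⁻¹ = Real.exp z / (1 + Real.exp z) := by
    field_simp
    ring
  rw [this]
  exact div_le_div_of_nonneg_left hpos.le (by positivity) (by linarith)

/-- If every margin `b j` is strictly below a level `s ≤ 0` which some margin `a i` of positive
weight reaches, then along the ray `t → ∞` the objective of `b` decays exponentially faster than
that of `a`, so it cannot dominate the latter up to a constant factor. -/
theorem not_dominated_of_lt {m l : ℕ} {w a : Fin m → ℝ} {u b : Fin l → ℝ} {K s : ℝ}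
    (hw : ∀ i, 0 < w i) (hu : ∀ j, 0 < u j) (hK : 0 ≤ K) (hs : s ≤ 0)
    (hb : ∀ j, b j < s) {i : Fin m} (ha : s ≤ a i) :
    ¬ ∀ t : ℝ, 0 ≤ t → f w (t • a) ≤ K * f u (t • b) := by
  intro h
  -- Dividing by `exp (t * s)` leaves a positive constant on the left and only decaying terms on the
  -- right.
  have hbound : ∀ t : ℝ, 0 ≤ t →
      w i / 2 ≤ K * ∑ j, u j * Real.exp (t * (b j - s)) := by
    intro t ht
    have h1 : w i * (Real.exp (t * s) / 2) ≤ f w (t • a) := by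
      calc w i * (Real.exp (t * s) / 2) ≤ w i * g (t * s) :=
            mul_le_mul_of_nonneg_left
              (exp_div_two_le_g (mul_nonpos_of_nonneg_of_nonpos ht hs)) (hw i).le
        _ ≤ w i * g ((t • a) i) :=
            mul_le_mul_of_nonneg_left (g_mono (mul_le_mul_of_nonneg_left ha ht)) (hw i).le
        _ ≤ f w (t • a) :=
            Finset.single_le_sum (f := fun i => w i * g ((t • a) i))
              (fun j _ => mul_nonneg (hw j).le (g_nonneg _)) (Finset.mem_univ i)
    have h2 : f u (t • b) ≤ (∑ j, u j * Real.exp (t * (b j - s))) * Real.exp (t * s) := by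
      rw [Finset.sum_mul]
      refine Finset.sum_le_sum fun j _ => ?_
      rw [mul_assoc, ← Real.exp_add, ← mul_add, sub_add_cancel]
      exact mul_le_mul_of_nonneg_left (g_le_exp _) (hu j).le
    have h3 := (h1.trans (h t ht)).trans (mul_le_mul_of_nonneg_left h2 hK)
    refine le_of_mul_le_mul_right ?_ (Real.exp_pos (t * s))
    linarith
  have hlim : Tendsto (fun t : ℝ => K * ∑ j, u j * Real.exp (t * (b j - s))) atTop (𝓝 0) := by
    have hj : ∀ j ∈ Finset.univ,
        Tendsto (fun t : ℝ => u j * Real.exp (t * (b j - s))) atTop (𝓝 (u j * 0)) :=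
      fun j _ => (Real.tendsto_exp_atBot.comp
        (tendsto_id.atTop_mul_const_of_neg (sub_neg.2 (hb j)))).const_mul _
    simpa using (tendsto_finsetSum _ hj).const_mul K
  have := ge_of_tendsto hlim ((eventually_ge_atTop 0).mono hbound)
  linarith [hw i]

theorem IsCoreset.le_one_add_mul {n k d : ℕ} {ε : ℝ} {X : Matrix (Fin n) (Fin d) ℝ}
    {C : Matrix (Fin k) (Fin d) ℝ} {u : Fin k → ℝ} (h : IsCoreset ε X (fun _ => 1) C u)
    (β : Fin d → ℝ) :
    f u (C *ᵥ β) ≤ (1 + ε) * f (fun _ => 1) (X *ᵥ β) := by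
  have := (abs_le.1 (h.2 β)).1
  linarith

theorem IsCoreset.le_inv_mul {n k d : ℕ} {ε : ℝ} (hε : ε < 1) {X : Matrix (Fin n) (Fin d) ℝ}
    {C : Matrix (Fin k) (Fin d) ℝ} {u : Fin k → ℝ} (h : IsCoreset ε X (fun _ => 1) C u)
    (β : Fin d → ℝ) :
    f (fun _ => 1) (X *ᵥ β) ≤ (1 - ε)⁻¹ * f u (C *ᵥ β) := by
  have := (abs_le.1 (h.2 β)).2
  rw [le_inv_mul_iff₀ (by linarith)]
  linarith

/-- A coreset has a point at least as far in direction `β` as any given input point, provided the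
latter lies in the half-plane `⟪·, β⟫ ≤ 0`. -/
theorem IsCoreset.exists_le {n k d : ℕ} {ε : ℝ} (hε : ε < 1)
    {X : Matrix (Fin n) (Fin d) ℝ} {C : Matrix (Fin k) (Fin d) ℝ} {u : Fin k → ℝ}
    (h : IsCoreset ε X (fun _ => 1) C u) (β : Fin d → ℝ) (i : Fin n) (hi : (X *ᵥ β) i ≤ 0) :
    ∃ j, (X *ᵥ β) i ≤ (C *ᵥ β) j := by
  by_contra! hlt
  refine not_dominated_of_lt (w := fun _ => 1) (fun _ => one_pos) h.1
    (inv_nonneg.2 (sub_nonneg.2 hε.le)) hi hlt le_rfl fun t _ => ?_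
  simpa [Matrix.mulVec_smul] using h.le_inv_mul hε (t • β)

/-- If all input points lie in the open half-plane `⟪·, β⟫ < s` with `s ≤ 0`, so do all points
of a coreset. -/
theorem IsCoreset.lt_of_forall_lt {n k d : ℕ} {ε s : ℝ} (hε : 0 < ε)
    {X : Matrix (Fin n) (Fin d) ℝ} {C : Matrix (Fin k) (Fin d) ℝ} {u : Fin k → ℝ}
    (h : IsCoreset ε X (fun _ => 1) C u) (β : Fin d → ℝ) (hs : s ≤ 0)
    (hX : ∀ i, (X *ᵥ β) i < s) (j : Fin k) : (C *ᵥ β) j < s := by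
  by_contra! hle
  refine not_dominated_of_lt (u := fun _ => 1) h.1 (fun _ => one_pos)
    (by linarith : (0 : ℝ) ≤ 1 + ε) hs hX hle fun t _ => ?_
  simpa [Matrix.mulVec_smul] using h.le_one_add_mul (t • β)

/-- The points `(i + 1, 1 / (i + 1))` on a branch of a hyperbola. -/
noncomputable def hyperbolaPoints (n : ℕ) : Matrix (Fin n) (Fin 2) ℝ :=
  Matrix.of fun i => ![(i : ℝ) + 1, ((i : ℝ) + 1)⁻¹]

/-- The direction in which the `i`-th point of the hyperbola is the unique extreme one. -/
noncomputable def hyperbolaNormal {n : ℕ} (i : Fin n) : Fin 2 → ℝ :=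
  ![-((i : ℝ) + 1)⁻¹, -((i : ℝ) + 1)]

/-- With `a = l + 1` and `b = i + 1` the margin is `-(a / b + b / a)`: AM-GM with its defect made
explicit, so the maximum `-2` occurs only at `l = i`. -/
theorem hyperbolaPoints_mulVec_normal {n : ℕ} (i l : Fin n) :
    (hyperbolaPoints n *ᵥ hyperbolaNormal i) l =
      -2 - ((l : ℝ) - i) ^ 2 / (((l : ℝ) + 1) * ((i : ℝ) + 1)) := by
  have hl : (l : ℝ) + 1 ≠ 0 := by positivity
  have hi : (i : ℝ) + 1 ≠ 0 := by positivity
  simp only [hyperbolaPoints, hyperbolaNormal, Matrix.mulVec, dotProduct, Fin.sum_univ_two,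
    Matrix.of_apply, Matrix.cons_val_zero, Matrix.cons_val_one]
  field_simp
  ring

theorem hyperbolaPoints_mulVec_normal_self {n : ℕ} (i : Fin n) :
    (hyperbolaPoints n *ᵥ hyperbolaNormal i) i = -2 := by
  simp [hyperbolaPoints_mulVec_normal]

theorem hyperbolaPoints_mulVec_normal_le {n : ℕ} (i l : Fin n) :
    (hyperbolaPoints n *ᵥ hyperbolaNormal i) l ≤ -2 := by
  rw [hyperbolaPoints_mulVec_normal]
  have : 0 ≤ ((l : ℝ) - i) ^ 2 / (((l : ℝ) + 1) * ((i : ℝ) + 1)) := by positivity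
  linarith

theorem hyperbolaPoints_mulVec_normal_lt {n : ℕ} {i l : Fin n} (h : l ≠ i) :
    (hyperbolaPoints n *ᵥ hyperbolaNormal i) l < -2 := by
  rw [hyperbolaPoints_mulVec_normal]
  have hne : (l : ℝ) - i ≠ 0 := sub_ne_zero.2 (by exact_mod_cast Fin.val_ne_of_ne h)
  have : 0 < ((l : ℝ) - i) ^ 2 / (((l : ℝ) + 1) * ((i : ℝ) + 1)) := by positivity
  linarith

/-- Every coreset of `n` points on a branch of a hyperbola has at least `n` points: a coreset point
that is extreme in the directions of two distinct input points would stick out in the sum of these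
directions. -/
theorem IsCoreset.card_le_of_hyperbolaPoints {n k : ℕ} {ε : ℝ} (hε₀ : 0 < ε) (hε₁ : ε < 1)
    {C : Matrix (Fin k) (Fin 2) ℝ} {u : Fin k → ℝ}
    (h : IsCoreset ε (hyperbolaPoints n) (fun _ => 1) C u) : n ≤ k := by
  have hex : ∀ i : Fin n, ∃ j, -2 ≤ (C *ᵥ hyperbolaNormal i) j := by
    intro i
    have := h.exists_le hε₁ (hyperbolaNormal i) i
    rw [hyperbolaPoints_mulVec_normal_self] at this
    exact this (by norm_num)
  choose φ hφ using hex
  have hinj : Function.Injective φ := by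
    intro i i' hii'
    by_contra hne
    -- A shared point would reach `-2 + -2`, but each input point misses `-2` in at least one of the
    -- two directions.
    have hlt := h.lt_of_forall_lt hε₀ (s := -4) (hyperbolaNormal i + hyperbolaNormal i')
      (by norm_num) (fun l => ?_) (φ i)
    · rw [Matrix.mulVec_add, Pi.add_apply] at hlt
      have h' := hφ i'
      rw [← hii'] at h'
      linarith [hφ i]
    · rw [Matrix.mulVec_add, Pi.add_apply]
      by_cases hl : l = i
      · have hl' : l ≠ i' := fun e => hne (hl.symm.trans e)
        linarith [hyperbolaPoints_mulVec_normal_le i l, hyperbolaPoints_mulVec_normal_lt hl']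
      · linarith [hyperbolaPoints_mulVec_normal_le i' l, hyperbolaPoints_mulVec_normal_lt hl]
  simpa using Fintype.card_le_of_injective φ hinj

theorem fold_neg_one {n d : ℕ} (Z : Matrix (Fin n) (Fin d) ℝ) : fold Z (fun _ => -1) = Z := by
  ext i j
  simp [fold]

end LogisticRegression

theorem corollary1 :
    ∃ c : ℝ, 0 < c ∧ ∀ n : ℕ, 2 ≤ n →
      ∃ (Z : Matrix (Fin n) (Fin 2) ℝ) (Y : Fin n → ℝ), (∀ i, Y i = -1 ∨ Y i = 1) ∧
        ∀ ε : ℝ, 0 < ε → ε < 1 →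
          ∀ (k : ℕ) (C : Matrix (Fin k) (Fin 2) ℝ) (u : Fin k → ℝ),
            LogisticRegression.IsCoreset ε (LogisticRegression.fold Z Y) (fun _ => 1) C u →
              c * ((n : ℝ) / Real.log (n : ℝ)) ≤ (k : ℝ) := by
  -- The choice `c = log 2` gives `c / log n ≤ 1` for all `n ≥ 2`.
  refine ⟨Real.log 2, Real.log_pos one_lt_two, fun n hn =>
    ⟨LogisticRegression.hyperbolaPoints n, fun _ => -1, fun _ => Or.inl rfl, ?_⟩⟩
  intro ε hε₀ hε₁ k C u h
  rw [LogisticRegression.fold_neg_one] at h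
  have hnk : (n : ℝ) ≤ k := by exact_mod_cast h.card_le_of_hyperbolaPoints hε₀ hε₁
  have hn' : (2 : ℝ) ≤ n := by exact_mod_cast hn
  have hlog : Real.log 2 ≤ Real.log n := Real.log_le_log two_pos hn'
  have hpos : 0 < Real.log n := (Real.log_pos one_lt_two).trans_le hlog
  refine le_trans ?_ hnk
  rw [← mul_div_assoc, div_le_iff₀ hpos, mul_comm]
  exact mul_le_mul_of_nonneg_left hlog (by positivity)
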